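/- Let $X$ be the complex Banach space $\ell_p$ ($1\le p<\infty$) or $c_0$ of sequences of complex numbers indexed by $\{0,1,2,\dots\}$, and let $e_n$ denote the $n$-th standard unit vector. Let $(w_n)_{n\ge 0}$ be a sequence of complex numbers with $w_n\to 0$, and let $T$ be the bounded linear operator on $X$ that is the weighted right shift with weights $(w_n)$, i.e. $Te_n=w_ne_{n+1}$ for all $n\ge 0$, equivalently $T(x_0,x_1,x_2,\dots)=(0,w_0x_0,w_1x_1,\dots)$. Then both $T$ and its Banach space adjoint $T^*\colon X^*\to X^*$, $T^*f=f\circ T$, have almost invariant half-spaces. Here a half-space of a Banach space $Z$ is a (norm-)closed linear subspace $Y\subseteq Z$ of infinite dimension and of infinite codimension in $Z$, and $Y$ is almost invariant under a bounded operator $S$ on $Z$ if there is a finite-dimensional subspace $F\subseteq Z$ with $S(Y)\subseteq Y+F$. -/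

import Mathlib

open Filter Topology
open scoped ENNReal ZeroAtInfty

/-- A half-space of a complex normed space `X`: a closed linear subspace of infinite dimension and
of infinite codimension. -/
structure IsHalfSpace {X : Type*} [NormedAddCommGroup X] [NormedSpace ℂ X]
    (Y : Submodule ℂ X) : Prop where
  isClosed : IsClosed (Y : Set X)
  infinite_dim : ¬ FiniteDimensional ℂ Y
  infinite_codim : ¬ FiniteDimensional ℂ (X ⧸ Y)

/-- `Y` is almost invariant under `T`: `T(Y) ⊆ Y + F` for some finite dimensional subspace `F`. -/
def IsAlmostInvariant {X : Type*} [NormedAddCommGroup X] [NormedSpace ℂ X]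
    (T : X →L[ℂ] X) (Y : Submodule ℂ X) : Prop :=
  ∃ F : Submodule ℂ X, FiniteDimensional ℂ F ∧ ∀ y ∈ Y, T y ∈ Y ⊔ F

/-- `T` has an almost invariant half-space. -/
def HasAlmostInvariantHalfSpace {X : Type*} [NormedAddCommGroup X] [NormedSpace ℂ X]
    (T : X →L[ℂ] X) : Prop :=
  ∃ Y : Submodule ℂ X, IsHalfSpace Y ∧ IsAlmostInvariant T Y

/-- The Banach space adjoint `T^* : X^* → X^*`, `T^* f = f ∘ T`, on the dual with its norm. -/
noncomputable def banachAdjoint {X : Type*} [NormedAddCommGroup X] [NormedSpace ℂ X]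
    (T : X →L[ℂ] X) : StrongDual ℂ X →L[ℂ] StrongDual ℂ X :=
  ContinuousLinearMap.precomp ℂ T

/-- The weighted right shift on sequences:
`(x₀, x₁, x₂, …) ↦ (0, w₀ x₀, w₁ x₁, …)`, that is, `eₙ ↦ wₙ eₙ₊₁`. -/
def weightedRightShift (w x : ℕ → ℂ) : ℕ → ℂ
  | 0 => 0
  | n + 1 => w n * x n

/-!
Suppose that the weights `w n` do not vanish (a tail of the shift suffices). The rescaled
coordinates `φ n x = x n / (w 0 ⋯ w (n - 1))` satisfy `φ (n + 1) ∘ T = φ n`, and since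
`w 0 ⋯ w (n - 1)` decays faster than geometrically there is, for each `z : ℂ`, a vector `x z` with
`φ m (x z) = z ^ m` for all `m`. Choose an infinite product `F z = ∏ (1 + μ i * z) = ∑ c m * z ^ m`
whose zeros go to infinity so fast that each `f j = ∑ c m • φ (m + j)` converges in norm. Then
`f (j + 1) ∘ T = f j` and `f j (x z) = z ^ j * F z`. The common kernel `Y` of the `f j` contains
`x z` for the infinitely many zeros `z` of `F`, has infinite codimension, and `T y ∈ Y` for every
`y ∈ Y` satisfying the single further condition `f 0 (T y) = 0`.

If infinitely many weights vanish, the shift is a direct sum of infinitely many shifts on blocks of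
coordinates, and every second block spans an invariant half-space.

The annihilator of an almost invariant half-space of `T` is one of the adjoint of `T`.
-/

section Annihilator

open StrongDual

variable {𝕜 X : Type*} [RCLike 𝕜] [NormedAddCommGroup X] [NormedSpace 𝕜 X]

theorem finiteDimensional_of_strongDual [FiniteDimensional 𝕜 (StrongDual 𝕜 X)] :
    FiniteDimensional 𝕜 X :=
  .of_injective _ (separatingDual_iff_injective.1 (inferInstanceAs (SeparatingDual 𝕜 X)))

theorem finiteDimensional_quotient_of_polarSubmodule {Y : Submodule 𝕜 X}
    (hY : IsClosed (Y : Set X)) [FiniteDimensional 𝕜 (polarSubmodule 𝕜 Y)] :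
    FiniteDimensional 𝕜 (X ⧸ Y) := by
  have : IsClosed (Y : Set X) := hY
  let ι : StrongDual 𝕜 (X ⧸ Y) →ₗ[𝕜] polarSubmodule 𝕜 Y :=
    (ContinuousLinearMap.precomp 𝕜 Y.mkQL).toLinearMap.codRestrict _ fun g =>
      (mem_polarSubmodule 𝕜 Y _).2 fun y hy => by
        simp [(Submodule.Quotient.mk_eq_zero Y).2 hy]
  have hι : Function.Bijective ι := by
    refine ⟨fun g h hgh => ContinuousLinearMap.ext fun q => ?_, fun f => ?_⟩
    · obtain ⟨x, rfl⟩ := Y.mkQ_surjective q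
      exact DFunLike.congr_fun (congrArg Subtype.val hgh) x
    · exact ⟨Y.liftQL f.1 ((mem_polarSubmodule 𝕜 Y f.1).1 f.2), rfl⟩
  have : FiniteDimensional 𝕜 (StrongDual 𝕜 (X ⧸ Y)) :=
    Module.Finite.equiv (LinearEquiv.ofBijective ι hι).symm
  exact finiteDimensional_of_strongDual

theorem finiteDimensional_of_quotient_polarSubmodule {Y : Submodule 𝕜 X}
    [FiniteDimensional 𝕜 (StrongDual 𝕜 X ⧸ polarSubmodule 𝕜 Y)] : FiniteDimensional 𝕜 Y := by
  let ρ : (StrongDual 𝕜 X ⧸ polarSubmodule 𝕜 Y) →ₗ[𝕜] StrongDual 𝕜 Y :=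
    (polarSubmodule 𝕜 Y).liftQ (ContinuousLinearMap.precomp 𝕜 Y.subtypeL).toLinearMap fun f hf =>
      ContinuousLinearMap.ext fun y => (mem_polarSubmodule 𝕜 Y f).1 hf y y.2
  have hρ : Function.Surjective ρ := fun g => by
    obtain ⟨f, hf, -⟩ := exists_extension_norm_eq Y g
    exact ⟨Submodule.Quotient.mk f, ContinuousLinearMap.ext hf⟩
  have : FiniteDimensional 𝕜 (StrongDual 𝕜 Y) := .of_surjective ρ hρ
  exact finiteDimensional_of_strongDual

end Annihilator

section HalfSpace

open StrongDual

variable {X : Type*} [NormedAddCommGroup X] [NormedSpace ℂ X]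

theorem IsHalfSpace.polarSubmodule {Y : Submodule ℂ X} (hY : IsHalfSpace Y) :
    IsHalfSpace (polarSubmodule ℂ Y) where
  isClosed :=
    (WeakDual.isClosed_polar ℂ (Y : Set X)).preimage NormedSpace.Dual.toWeakDual_continuous
  infinite_dim _ := hY.infinite_codim (finiteDimensional_quotient_of_polarSubmodule hY.isClosed)
  infinite_codim _ := hY.infinite_dim finiteDimensional_of_quotient_polarSubmodule

theorem not_finiteDimensional_quotient_of_le_ker {ι : Type*} [Infinite ι]
    {f : ι → StrongDual ℂ X} (hf : LinearIndependent ℂ f) {Y : Submodule ℂ X}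
    (hY : ∀ i, Y ≤ (f i).ker) : ¬ FiniteDimensional ℂ (X ⧸ Y) := fun _ => by
  have hf' : LinearIndependent ℂ fun i => (f i).toLinearMap :=
    hf.map_injOn (ContinuousLinearMap.coeLM ℂ) ContinuousLinearMap.coe_injective.injOn
  have hli : LinearIndependent ℂ fun i => Y.liftQ (f i).toLinearMap (hY i) :=
    .of_comp Y.mkQ.dualMap hf'
  exact not_finite_iff_infinite.2 ‹_› hli.finite

theorem isHalfSpace_iInf_ker {ι κ : Type*} [Infinite ι] [Infinite κ] {f : ι → StrongDual ℂ X}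
    (hf : LinearIndependent ℂ f) {u : κ → X} (hu : LinearIndependent ℂ u)
    (hfu : ∀ i j, f i (u j) = 0) : IsHalfSpace (⨅ i, (f i).ker) where
  isClosed := by
    rw [Submodule.coe_iInf]
    exact isClosed_iInter fun i => (f i).isClosed_ker
  infinite_dim _ := by
    have huY : ∀ j, u j ∈ ⨅ i, (f i).ker := fun j => Submodule.mem_iInf _ |>.2 fun i => hfu i j
    have hli : LinearIndependent ℂ fun j => (⟨u j, huY j⟩ : ↥(⨅ i, (f i).ker)) :=
      .of_comp (Submodule.subtype _) hu
    exact not_finite_iff_infinite.2 ‹_› hli.finite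
  infinite_codim := not_finiteDimensional_quotient_of_le_ker hf (iInf_le _)

theorem isAlmostInvariant_of_ker {W : Type*} [AddCommGroup W] [Module ℂ W]
    [FiniteDimensional ℂ W] {T : X →L[ℂ] X} {Y : Submodule ℂ X} (r : X →ₗ[ℂ] W)
    (hr : ∀ y ∈ Y, r y = 0 → T y ∈ Y) : IsAlmostInvariant T Y := by
  obtain ⟨C, hC⟩ := (r.domRestrict Y).ker.exists_isCompl
  have : FiniteDimensional ℂ C :=
    Module.Finite.iff_fg.2 (Submodule.CoFG.fg_of_isCompl hC (.ker _))
  refine ⟨C.map (T.toLinearMap ∘ₗ Y.subtype), inferInstance, fun y hy => ?_⟩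
  obtain ⟨k, c, hk, hc, hkc⟩ := Submodule.codisjoint_iff_exists_add_eq.1 hC.codisjoint ⟨y, hy⟩
  obtain rfl : (k : X) + c = y := congrArg Subtype.val hkc
  rw [map_add]
  exact Submodule.add_mem_sup (hr k k.2 hk) (Submodule.mem_map_of_mem hc)

theorem IsAlmostInvariant.polarSubmodule {T : X →L[ℂ] X} {Y : Submodule ℂ X}
    (h : IsAlmostInvariant T Y) :
    IsAlmostInvariant (banachAdjoint T) (polarSubmodule ℂ Y) := by
  obtain ⟨F, _, hTF⟩ := h
  refine isAlmostInvariant_of_ker (ContinuousLinearMap.precomp ℂ F.subtypeL).toLinearMap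
    fun f hfY hfF => (mem_polarSubmodule ℂ Y _).2 fun y hy => ?_
  obtain ⟨y', hy', v, hv, hyv⟩ := Submodule.mem_sup.1 (hTF y hy)
  calc f (T y) = f y' + f v := by rw [← hyv, map_add]
    _ = 0 := by
      rw [(mem_polarSubmodule ℂ Y f).1 hfY y' hy', zero_add]
      exact DFunLike.congr_fun hfF ⟨v, hv⟩

theorem HasAlmostInvariantHalfSpace.banachAdjoint {T : X →L[ℂ] X} :
    HasAlmostInvariantHalfSpace T → HasAlmostInvariantHalfSpace (banachAdjoint T)
  | ⟨_, hY, hT⟩ => ⟨_, hY.polarSubmodule, hT.polarSubmodule⟩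

theorem hasAlmostInvariantHalfSpace_of_chain {T : X →L[ℂ] X} {f : ℕ → StrongDual ℂ X}
    (hf : LinearIndependent ℂ f) (hfT : ∀ j x, f (j + 1) (T x) = f j x) {κ : Type*} [Infinite κ]
    {u : κ → X} (hu : LinearIndependent ℂ u) (hfu : ∀ j i, f j (u i) = 0) :
    HasAlmostInvariantHalfSpace T := by
  refine ⟨⨅ j, (f j).ker, isHalfSpace_iInf_ker hf hu hfu,
    isAlmostInvariant_of_ker (f 0 ∘L T).toLinearMap fun y hy hy0 => ?_⟩
  rw [Submodule.mem_iInf] at hy ⊢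
  rintro (_ | j)
  · exact hy0
  · exact (hfT j y).trans (hy j)

end HalfSpace

section ProductSeries

variable {ι R : Type*}

/-- The elementary symmetric function of degree `m` of the family `μ`, that is, the coefficient of
`z ^ m` in the power series of the infinite product `∏ i, (1 + μ i * z)`. -/
noncomputable def elementarySymmetricSum [CommSemiring R] [TopologicalSpace R] (μ : ι → R)
    (m : ℕ) : R :=
  ∑' s : {s : Finset ι // s.card = m}, ∏ i ∈ s.1, μ i

theorem hasSum_elementarySymmetricSum_mul_pow [NormedCommRing R] [NormOneClass R]
    [CompleteSpace R] {μ : ι → R} (hμ : Summable fun i => ‖μ i‖) (z : R) :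
    HasSum (fun m => elementarySymmetricSum μ m * z ^ m) (∏' i, (1 + μ i * z)) := by
  have hsum : Summable fun s : Finset ι => ∏ i ∈ s, μ i * z :=
    summable_finsetProd_of_summable_norm <|
      .of_nonneg_of_le (fun _ => norm_nonneg _) (fun i => norm_mul_le (μ i) z) (hμ.mul_right ‖z‖)
  rw [tprod_one_add hsum, ← (Equiv.sigmaFiberEquiv Finset.card).tsum_eq]
  refine ((Equiv.sigmaFiberEquiv Finset.card).summable_iff.2 hsum).hasSum.sigma fun m => ?_
  have hfiber : Summable fun s : {s : Finset ι // s.card = m} => ∏ i ∈ s.1, μ i :=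
    (summable_finsetProd_of_summable_norm hμ).comp_injective Subtype.val_injective
  convert! hfiber.hasSum.mul_right (z ^ m) using 2 with s
  simp [Finset.prod_mul_distrib, s.2]

theorem summable_mul_norm_elementarySymmetricSum [NormedCommRing R] {μ : ι → R} {D : ℕ → ℝ}
    (hD : ∀ m, 0 < D m) (hμ : Summable fun s : Finset ι => D s.card * ‖∏ i ∈ s, μ i‖) :
    Summable fun m => D m * ‖elementarySymmetricSum μ m‖ := by
  refine .of_nonneg_of_le (fun m => mul_nonneg (hD m).le (norm_nonneg _)) (fun m => ?_)
    ((Equiv.sigmaFiberEquiv Finset.card).summable_iff.2 hμ).sigma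
  have hfiber : (fun s : {s : Finset ι // s.card = m} => D s.1.card * ‖∏ i ∈ s.1, μ i‖) =
      fun s => D m * ‖∏ i ∈ s.1, μ i‖ := funext fun s => by rw [s.2]
  have hnorm : Summable fun s : {s : Finset ι // s.card = m} => ‖∏ i ∈ s.1, μ i‖ := by
    rw [← summable_mul_left_iff (hD m).ne', ← hfiber]
    exact hμ.comp_injective Subtype.val_injective
  calc D m * ‖elementarySymmetricSum μ m‖
      ≤ D m * ∑' s : {s : Finset ι // s.card = m}, ‖∏ i ∈ s.1, μ i‖ :=
        mul_le_mul_of_nonneg_left (norm_tsum_le_tsum_norm hnorm) (hD m).le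
    _ = ∑' s : {s : Finset ι // s.card = m}, D s.1.card * ‖∏ i ∈ s.1, μ i‖ := by
      rw [hfiber, tsum_mul_left]

theorem apply_card_le_mul_prod {E : ℕ → ℝ} (hE : Monotone E) (hE1 : ∀ n, 1 ≤ E n)
    (s : Finset ℕ) : E s.card ≤ E 0 * ∏ i ∈ s, E (i + 1) := by
  rcases s.eq_empty_or_nonempty with rfl | hs
  · simp
  have hcard : s.card ≤ s.max' hs + 1 := by
    simpa using Finset.card_le_card (t := Finset.range (s.max' hs + 1)) fun i hi =>
      Finset.mem_range_succ_iff.2 (s.le_max' i hi)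
  have hprod : E (s.max' hs + 1) ≤ ∏ i ∈ s, E (i + 1) := by
    simpa using Finset.prod_le_prod_of_subset_of_one_le (f := fun i => E (i + 1))
      (Finset.singleton_subset_iff.2 (s.max'_mem hs)) (by simp [zero_le_one.trans (hE1 _)])
      fun i _ _ => hE1 (i + 1)
  calc E s.card ≤ E (s.max' hs + 1) := hE hcard
    _ ≤ ∏ i ∈ s, E (i + 1) := hprod
    _ ≤ E 0 * ∏ i ∈ s, E (i + 1) :=
      le_mul_of_one_le_left (Finset.prod_nonneg fun i _ => zero_le_one.trans (hE1 _)) (hE1 0)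

theorem summable_apply_card_mul_prod {E : ℕ → ℝ} (hE : Monotone E) (hE1 : ∀ n, 1 ≤ E n) :
    Summable fun s : Finset ℕ => E s.card * ∏ i ∈ s, (1 / 2) ^ i * (E (i + 1))⁻¹ := by
  have hE0 : ∀ n, 0 < E n := fun n => zero_lt_one.trans_le (hE1 n)
  have hgeom : Summable fun s : Finset ℕ => ∏ i ∈ s, (1 / 2 : ℝ) ^ i :=
    summable_finsetProd_of_summable_norm summable_geometric_two.norm
  refine (hgeom.mul_left (E 0)).of_nonneg_of_le
    (fun s => mul_nonneg (hE0 _).le (Finset.prod_nonneg fun i _ => ?_)) fun s => ?_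
  · exact mul_nonneg (by positivity) (inv_nonneg.2 (hE0 _).le)
  calc E s.card * ∏ i ∈ s, (1 / 2) ^ i * (E (i + 1))⁻¹
      = E s.card / (∏ i ∈ s, E (i + 1)) * ∏ i ∈ s, (1 / 2) ^ i := by
        rw [Finset.prod_mul_distrib, Finset.prod_inv_distrib]
        ring
    _ ≤ E 0 * ∏ i ∈ s, (1 / 2) ^ i := by
        gcongr
        exact div_le_of_le_mul₀ (Finset.prod_nonneg fun i _ => (hE0 _).le) (hE0 0).le
          (apply_card_le_mul_prod hE hE1 s)

theorem exists_powerSeries_summable_monotone_mul {D : ℕ → ℝ} (hD : Monotone D)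
    (hD1 : ∀ m, 1 ≤ D m) :
    ∃ (c : ℕ → ℂ) (F : ℂ → ℂ), (Summable fun m => D m * ‖c m‖) ∧
      (∀ z, HasSum (fun m => c m * z ^ m) (F z)) ∧
      {z | F z = 0}.Infinite ∧ {z | F z ≠ 0}.Infinite := by
  have hD0 : ∀ m, 0 < D m := fun m => zero_lt_one.trans_le (hD1 m)
  let ε : ℕ → ℝ := fun i => (1 / 2) ^ i * (D (i + 1))⁻¹
  have hε : ∀ i, 0 < ε i := fun i => mul_pos (by positivity) (inv_pos.2 (hD0 _))
  have hε_anti : StrictAnti ε := strictAnti_nat_of_succ_lt fun i =>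
    mul_lt_mul_of_lt_of_le_of_pos_of_nonneg
      (pow_lt_pow_right_of_lt_one₀ (by norm_num) (by norm_num) i.lt_succ_self)
      (inv_anti₀ (hD0 _) (hD (Nat.le_succ _))) (inv_pos.2 (hD0 _)) (by positivity)
  have hε_norm : ∀ i, ‖(ε i : ℂ)‖ = ε i := fun i => RCLike.norm_of_nonneg (hε i).le
  have hε_sum : Summable fun i => ‖(ε i : ℂ)‖ :=
    summable_geometric_two.of_nonneg_of_le (fun _ => norm_nonneg _) fun i =>
      (hε_norm i).trans_le
        (mul_le_of_le_one_right (by positivity) (inv_le_one_of_one_le₀ (hD1 _)))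
  refine ⟨elementarySymmetricSum fun i => (ε i : ℂ), fun z => ∏' i, (1 + ε i * z),
    summable_mul_norm_elementarySymmetricSum hD0 ?_, hasSum_elementarySymmetricSum_mul_pow hε_sum,
    ?_, ?_⟩
  · simpa only [norm_prod, hε_norm] using summable_apply_card_mul_prod hD hD1
  · refine Set.infinite_of_injective_forall_mem (f := fun i => -(ε i : ℂ)⁻¹)
      (fun i j h => hε_anti.injective (by simpa using h)) fun i => ?_
    exact tprod_of_exists_eq_zero ⟨i, by simp [(hε i).ne']⟩
  · refine Set.infinite_of_injective_forall_mem Nat.cast_injective fun n : ℕ =>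
      tprod_one_add_ne_zero_of_summable (fun i => ?_) ?_
    · have : 0 < 1 + ε i * n := by have := hε i; positivity
      exact_mod_cast this.ne'
    · simpa only [norm_mul] using hε_sum.mul_right ‖(n : ℂ)‖

theorem exists_powerSeries_summable_mul (a : ℕ → ℝ) (ha : ∀ m, 0 ≤ a m) :
    ∃ (c : ℕ → ℂ) (F : ℂ → ℂ), (∀ j, Summable fun m => ‖c m‖ * a (m + j)) ∧
      (∀ z, HasSum (fun m => c m * z ^ m) (F z)) ∧
      {z | F z = 0}.Infinite ∧ {z | F z ≠ 0}.Infinite := by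
  -- `D m` dominates `a (m + j)` for every `j ≤ m`, hence for each `j` and almost all `m`.
  let D : ℕ → ℝ := fun m => 1 + ∑ l ∈ Finset.range (2 * m + 1), a l
  have hD : Monotone D := fun m n h => by
    have hsub : Finset.range (2 * m + 1) ⊆ Finset.range (2 * n + 1) :=
      Finset.range_mono (by lia)
    exact add_le_add_right (Finset.sum_le_sum_of_subset_of_nonneg hsub fun l _ _ => ha l) 1
  have hD1 : ∀ m, 1 ≤ D m := fun m => le_add_of_nonneg_right (Finset.sum_nonneg fun l _ => ha l)
  have haD : ∀ j m, j ≤ m → a (m + j) ≤ D m := fun j m hjm =>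
    (Finset.single_le_sum (fun l _ => ha l) (Finset.mem_range.2 (by lia))).trans
      (le_add_of_nonneg_left zero_le_one)
  obtain ⟨c, F, hc, hF, hzero, hne⟩ := exists_powerSeries_summable_monotone_mul hD hD1
  refine ⟨c, F, fun j => .of_norm_bounded_eventually_nat hc ?_, hF, hzero, hne⟩
  filter_upwards [eventually_ge_atTop j] with m hm
  rw [Real.norm_of_nonneg (mul_nonneg (norm_nonneg _) (ha _)), mul_comm]
  exact mul_le_mul_of_nonneg_right (haD j m hm) (norm_nonneg _)

end ProductSeries

section BackwardOrbit

theorem linearIndependent_geometric (K : Type*) [Field K] :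
    LinearIndependent K fun (z : K) (m : ℕ) => z ^ m := by
  refine Module.End.eigenvectors_linearIndependent' (LinearMap.funLeft K K Nat.succ) _
    Function.injective_id _
    fun z => Module.End.hasEigenvector_iff.2 ⟨Module.End.mem_eigenspace_iff.2 ?_, fun h => ?_⟩
  · ext m
    simp [LinearMap.funLeft_apply, pow_succ']
  · simpa using congrFun h 0

theorem linearIndependent_pow_of_infinite {R : Type*} [CommRing R] [IsDomain R] {S : Set R}
    (hS : S.Infinite) : LinearIndependent R fun (j : ℕ) (z : S) => (z : R) ^ j := by
  let Φ : Polynomial R →ₗ[R] (S → R) := LinearMap.pi fun z => Polynomial.leval z.1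
  have hΦ : LinearMap.ker Φ = ⊥ := (LinearMap.ker_eq_bot').2 fun p hp =>
    p.eq_zero_of_infinite_isRoot (hS.mono fun z hz => congrFun hp ⟨z, hz⟩)
  have := (Polynomial.basisMonomials R).linearIndependent.map' Φ hΦ
  convert! this with j z
  simp [Φ]

variable {X : Type*} [NormedAddCommGroup X] [NormedSpace ℂ X]

theorem hasAlmostInvariantHalfSpace_of_backward_orbit {T : X →L[ℂ] X} {φ : ℕ → StrongDual ℂ X}
    (hφT : ∀ n x, φ (n + 1) (T x) = φ n x) (hφ : ∀ z : ℂ, ∃ x, ∀ m, φ m x = z ^ m) :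
    HasAlmostInvariantHalfSpace T := by
  obtain ⟨c, F, hc, hF, hzero, hne⟩ :=
    exists_powerSeries_summable_mul (fun m => ‖φ m‖) fun _ => norm_nonneg _
  choose x hx using hφ
  let f : ℕ → StrongDual ℂ X := fun j => ∑' m, c m • φ (m + j)
  have hf : ∀ j y, HasSum (fun m => c m * φ (m + j) y) (f j y) := fun j y =>
    (Summable.of_norm (by simpa only [norm_smul] using hc j)).hasSum.mapL
      (ContinuousLinearMap.apply ℂ ℂ y)
  have hfT : ∀ j y, f (j + 1) (T y) = f j y := fun j y =>
    (hf (j + 1) (T y)).unique (by simpa only [← add_assoc, hφT] using hf j y)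
  have hfx : ∀ j z, f j (x z) = F z * z ^ j := fun j z =>
    (hf j (x z)).unique
      (by simpa only [hx, pow_add, mul_assoc] using (hF z).mul_right (z ^ j))
  have hf_li : LinearIndependent ℂ f := by
    let Φ : StrongDual ℂ X →ₗ[ℂ] ({z | F z ≠ 0} → ℂ) := LinearMap.pi fun z =>
      (F z)⁻¹ • (ContinuousLinearMap.apply ℂ ℂ (x z)).toLinearMap
    have hΦ : Φ ∘ f = fun j (z : {z | F z ≠ 0}) => (z : ℂ) ^ j := by
      ext j z
      simp [Φ, hfx, inv_mul_cancel_left₀ z.2]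
    exact .of_comp Φ (hΦ ▸ linearIndependent_pow_of_infinite hne)
  have hx_li : LinearIndependent ℂ x := by
    have hφx : (LinearMap.pi fun m => (φ m).toLinearMap) ∘ x = fun z m => z ^ m :=
      funext₂ hx
    exact .of_comp _ (hφx ▸ linearIndependent_geometric ℂ)
  have := hzero.to_subtype
  exact hasAlmostInvariantHalfSpace_of_chain hf_li hfT
    (hx_li.comp ((↑) : {z | F z = 0} → ℂ) Subtype.val_injective) fun j z => by
      rw [Function.comp_apply, hfx, z.2, zero_mul]

end BackwardOrbit

section Shift

variable {X : Type*} [NormedAddCommGroup X] [NormedSpace ℂ X] {δ : ℕ → StrongDual ℂ X}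
  {w : ℕ → ℂ} {T : X →L[ℂ] X}

/-- The functionals `δ n` are the coordinates of a sequence space containing `ℓ¹`: every summable
sequence is the coordinate sequence of a vector. The `δ n` need not separate points. -/
def IsCoordinateSystem (δ : ℕ → StrongDual ℂ X) : Prop :=
  ∀ a : ℕ → ℂ, Summable a → ∃ x, ∀ n, δ n x = a n

theorem IsCoordinateSystem.exists_unitVectors (hδ : IsCoordinateSystem δ) :
    ∃ e : ℕ → X, ∀ m n, δ m (e n) = Pi.single (M := fun _ => ℂ) n 1 m := by
  choose e he using fun n => hδ (Pi.single n 1) (hasSum_pi_single n 1).summable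
  exact ⟨e, fun m n => he n m⟩

theorem IsCoordinateSystem.isHalfSpace_iInf_ker (hδ : IsCoordinateSystem δ) {A : Set ℕ}
    (hA : A.Infinite) (hAc : Aᶜ.Infinite) : IsHalfSpace (⨅ n : (Aᶜ : Set ℕ), (δ n).ker) := by
  have := hA.to_subtype
  have := hAc.to_subtype
  obtain ⟨e, he⟩ := hδ.exists_unitVectors
  have hδ_li : LinearIndependent ℂ δ :=
    .of_pairwise_dual_eq_zero_one δ
      (fun n => (ContinuousLinearMap.apply ℂ ℂ (e n)).toLinearMap)
      (fun m n hmn => by simp [he, hmn.symm]) fun n => by simp [he]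
  have he_li : LinearIndependent ℂ e :=
    .of_pairwise_dual_eq_zero_one e (fun n => (δ n).toLinearMap)
      (fun m n hmn => by simp [he, hmn]) fun n => by simp [he]
  exact _root_.isHalfSpace_iInf_ker (hδ_li.comp _ Subtype.val_injective)
    (he_li.comp ((↑) : A → ℕ) Subtype.val_injective) fun m n => by
      simp [he, Pi.single_eq_of_ne fun h : (m : ℕ) = n => m.2 (h ▸ n.2)]

theorem infinite_setOf_count {p q : ℕ → Prop} [DecidablePred p] (hp : {n | p n}.Infinite)
    (hq : ∃ᶠ k in atTop, q k) : {n | q (Nat.count p n)}.Infinite :=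
  (Nat.frequently_atTop_iff_infinite.1 hq).preimage <|
    (Nat.surjective_count_of_infinite_setOfPred hp).range_eq ▸ Set.subset_univ _

theorem hasAlmostInvariantHalfSpace_of_infinite_zeros (hδ : IsCoordinateSystem δ)
    (hT : ∀ x n, δ (n + 1) (T x) = w n * δ n x) (hw : {n | w n = 0}.Infinite) :
    HasAlmostInvariantHalfSpace T := by
  classical
  -- The zeros of `w` cut `ℕ` into blocks that `T` does not connect; `A` takes every second one.
  let A : Set ℕ := {n | Even (Nat.count (w · = 0) n)}
  have hA : A.Infinite := infinite_setOf_count hw Nat.frequently_even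
  have hAc : Aᶜ.Infinite := infinite_setOf_count hw (q := (¬ Even ·)) <|
    Nat.frequently_odd.mono fun _ => Nat.not_even_iff_odd.2
  refine ⟨_, hδ.isHalfSpace_iInf_ker hA hAc, ⊥, inferInstance, fun y hy => ?_⟩
  simp only [sup_bot_eq, Submodule.mem_iInf, Subtype.forall] at hy ⊢
  rintro (_ | n) hn
  · exact absurd (by simp [A]) hn
  · rw [LinearMap.mem_ker]
    by_cases hwn : w n = 0
    · exact (hT y n).trans (by rw [hwn, zero_mul])
    · have hnA : n ∈ Aᶜ := by simpa [A, Nat.count_succ, hwn] using hn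
      exact (hT y n).trans (by rw [show δ n y = 0 from hy n hnA, mul_zero])

theorem hasAlmostInvariantHalfSpace_of_eventually_ne_zero (hδ : IsCoordinateSystem δ)
    (hT : ∀ x n, δ (n + 1) (T x) = w n * δ n x) {N : ℕ} (hN : ∀ n, w (N + n) ≠ 0)
    (hw : ∀ z : ℂ, Summable fun m => z ^ m * ∏ l ∈ Finset.range m, w (N + l)) :
    HasAlmostInvariantHalfSpace T := by
  let W : ℕ → ℂ := fun m => ∏ l ∈ Finset.range m, w (N + l)
  have hW : ∀ m, W m ≠ 0 := fun m => Finset.prod_ne_zero_iff.2 fun l _ => hN l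
  refine hasAlmostInvariantHalfSpace_of_backward_orbit (φ := fun n => (W n)⁻¹ • δ (N + n))
    (fun n x => ?_) fun z => ?_
  · calc (W (n + 1))⁻¹ * δ (N + n + 1) (T x)
        = (W n * w (N + n))⁻¹ * (w (N + n) * δ (N + n) x) := by
          rw [hT, ← Finset.prod_range_succ]
      _ = (W n)⁻¹ * δ (N + n) x := by
        rw [mul_inv, mul_assoc, inv_mul_cancel_left₀ (hN n)]
  · let a : ℕ → ℂ := fun n => if n < N then 0 else z ^ (n - N) * W (n - N)
    have ha : Summable a := (summable_nat_add_iff N).1 (by simpa [a] using hw z)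
    obtain ⟨x, hx⟩ := hδ a ha
    refine ⟨x, fun m => ?_⟩
    simp [hx, a, mul_comm (z ^ m), inv_mul_cancel_left₀ (hW m)]

theorem summable_pow_mul_prod_of_tendsto_zero {𝕜 : Type*} [NormedField 𝕜] [CompleteSpace 𝕜]
    {w : ℕ → 𝕜} (hw : Tendsto w atTop (𝓝 0)) (N : ℕ) (z : 𝕜) :
    Summable fun m => z ^ m * ∏ l ∈ Finset.range m, w (N + l) := by
  refine summable_of_ratio_norm_eventually_le one_half_lt_one ?_
  have hlim : Tendsto (fun m => ‖z * w (N + m)‖) atTop (𝓝 0) := by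
    simpa [add_comm] using ((hw.comp (tendsto_add_atTop_nat N)).const_mul z).norm
  filter_upwards [hlim.eventually_le_const one_half_pos] with m hm
  calc ‖z ^ (m + 1) * ∏ l ∈ Finset.range (m + 1), w (N + l)‖
      = ‖z * w (N + m)‖ * ‖z ^ m * ∏ l ∈ Finset.range m, w (N + l)‖ := by
        rw [← norm_mul, Finset.prod_range_succ]
        ring_nf
    _ ≤ 1 / 2 * ‖z ^ m * ∏ l ∈ Finset.range m, w (N + l)‖ := by gcongr

theorem isCoordinateSystem_lp (p : ℝ≥0∞) [hp : Fact (1 ≤ p)] :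
    IsCoordinateSystem (lp.evalCLM ℂ (fun _ : ℕ => ℂ) p) := fun a ha =>
  ⟨⟨a, .of_exponent_ge (memℓp_gen (p := 1) (by simpa using ha.norm)) hp.out⟩, fun _ => rfl⟩

/-- Evaluation at a point, as a continuous linear functional on `C₀(α, 𝕜)`. -/
noncomputable def zeroAtInftyEval {α : Type*} (𝕜 : Type*) [TopologicalSpace α] [RCLike 𝕜] (t : α) :
    StrongDual 𝕜 C₀(α, 𝕜) :=
  LinearMap.mkContinuous
    { toFun := fun x => x t, map_add' := fun _ _ => rfl, map_smul' := fun _ _ => rfl } 1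
    fun x => (x.toBCF.norm_coe_le_norm t).trans_eq (one_mul _).symm

theorem isCoordinateSystem_zeroAtInfty : IsCoordinateSystem (zeroAtInftyEval (α := ℕ) ℂ) :=
  fun a ha => ⟨⟨⟨a, continuous_of_discreteTopology⟩, by
    rw [cocompact_eq_cofinite]
    exact ha.tendsto_cofinite_zero⟩, fun _ => rfl⟩

theorem corollary3p4_general (hδ : IsCoordinateSystem δ)
    (hw : ∀ (N : ℕ) (z : ℂ), Summable fun m => z ^ m * ∏ l ∈ Finset.range m, w (N + l))
    (hT : ∀ x n, δ (n + 1) (T x) = w n * δ n x) :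
    HasAlmostInvariantHalfSpace T ∧ HasAlmostInvariantHalfSpace (banachAdjoint T) := by
  suffices h : HasAlmostInvariantHalfSpace T from ⟨h, h.banachAdjoint⟩
  by_cases hinf : {n | w n = 0}.Infinite
  · exact hasAlmostInvariantHalfSpace_of_infinite_zeros hδ hT hinf
  · obtain ⟨B, hB⟩ := (Set.not_infinite.1 hinf).bddAbove
    have hne : ∀ n, w (B + 1 + n) ≠ 0 := fun n hn => by
      have : B + 1 + n ≤ B := hB hn
      lia
    exact hasAlmostInvariantHalfSpace_of_eventually_ne_zero hδ hT hne (hw (B + 1))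

end Shift

/-- The space `c₀` is `C₀(ℕ, ℂ)`: the functions on the discrete space `ℕ` that vanish at infinity,
with the supremum norm. -/
theorem corollary3p4 (w : ℕ → ℂ) (hw : Tendsto w atTop (𝓝 0)) :
    (∀ (p : ℝ≥0∞) [Fact (1 ≤ p)], p ≠ ∞ →
      ∀ T : lp (fun _ : ℕ => ℂ) p →L[ℂ] lp (fun _ : ℕ => ℂ) p,
        (∀ (x : lp (fun _ : ℕ => ℂ) p) (n : ℕ), (T x) n = weightedRightShift w x n) →
          HasAlmostInvariantHalfSpace T ∧ HasAlmostInvariantHalfSpace (banachAdjoint T)) ∧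
    (∀ T : C₀(ℕ, ℂ) →L[ℂ] C₀(ℕ, ℂ),
        (∀ (x : C₀(ℕ, ℂ)) (n : ℕ), (T x) n = weightedRightShift w x n) →
          HasAlmostInvariantHalfSpace T ∧ HasAlmostInvariantHalfSpace (banachAdjoint T)) :=
  ⟨fun p _ _ _ hT => corollary3p4_general (isCoordinateSystem_lp p)
    (summable_pow_mul_prod_of_tendsto_zero hw) fun x n => hT x (n + 1),
  fun _ hT => corollary3p4_general isCoordinateSystem_zeroAtInfty
    (summable_pow_mul_prod_of_tendsto_zero hw) fun x n => hT x (n + 1)⟩
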